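/- For an abelian group $G$, a subgroup $S\le G$ and $f\in G\setminus S$, let $Y_f(G,S)$ be the set of all finitely supported functions $y\colon G\to\mathbb Z_{\ge 0}$ with $\sum_{r\in G} y(r)\,r\in f+S$, and let $R_f(G,S)\subseteq\mathbb R^{(G)}$ be its convex hull. A function $\pi\colon G\to\mathbb R$ is a valid function for $R_f(G,S)$ if $\pi\ge 0$ and $\sum_{r}\pi(r)y(r)\ge 1$ for all $y\in R_f(G,S)$. A valid function $\pi$ is minimal if there is no valid function $\pi'\ne\pi$ with $\pi'\le\pi$ pointwise; it is extreme if, for all valid functions $\pi^1,\pi^2$, $\pi=\frac12(\pi^1+\pi^2)$ implies $\pi=\pi^1=\pi^2$; and it is a facet if every valid function $\pi'$ with $P(\pi)\subseteq P(\pi')$ equals $\pi$, where $P(\pi)=\{y\in Y_f(G,S) : \sum_r\pi(r)y(r)=1\}$. **Theorem.** Let $m\ge 3$ and $q\ge 1$ be integers, and let $f\in\frac1q\mathbb Z\setminus\mathbb Z$. Let $\pi\colon\mathbb R\to\mathbb R$ be a minimal valid function for $R_f(\mathbb R,\mathbb Z)$ that is continuous piecewise linear with breakpoints in $\frac1q\mathbb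 Z$, i.e., $\pi$ is affine on each interval $[\frac kq,\frac{k+1}q]$, $k\in\mathbb Z$. Then the following are equivalent: 1. $\pi$ is a facet for $R_f(\mathbb R,\mathbb Z)$; 2. $\pi$ is extreme for $R_f(\mathbb R,\mathbb Z)$; 3. the restriction $\pi|_{\frac1{mq}\mathbb Z}$ is extreme for $R_f(\frac1{mq}\mathbb Z,\mathbb Z)$. -/

import Mathlib

namespace GroupProblem

section General

variable {G : Type*} [AddCommGroup G]

/-- The finitely supported functions `y : G → ℝ` with values in the nonnegative integers such that
`∑ r, y(r) • r` lies in the coset `f + S`. -/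
def feasibleSolutions (f : G) (S : AddSubgroup G) : Set (G →₀ ℝ) :=
  {y | ∃ n : G →₀ ℕ, (∀ r, y r = (n r : ℝ)) ∧ (n.sum fun r k => k • r) - f ∈ S}

/-- The group problem `R_f(G,S)`: the convex hull of the feasible solutions in `ℝ^(G)`. -/
def groupProblem (f : G) (S : AddSubgroup G) : Set (G →₀ ℝ) :=
  convexHull ℝ (feasibleSolutions f S)

/-- The finite sum `∑ r, π(r) y(r)`. -/
def pairing (π : G → ℝ) (y : G →₀ ℝ) : ℝ := y.sum fun r t => π r * t

/-- `π` is a valid function for `R_f(G,S)`. -/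
def IsValid (f : G) (S : AddSubgroup G) (π : G → ℝ) : Prop :=
  (∀ r, 0 ≤ π r) ∧ ∀ y ∈ groupProblem f S, 1 ≤ pairing π y

/-- `π` is a minimal valid function for `R_f(G,S)`. -/
def IsMinimalValid (f : G) (S : AddSubgroup G) (π : G → ℝ) : Prop :=
  IsValid f S π ∧ ∀ π' : G → ℝ, IsValid f S π' → (∀ r, π' r ≤ π r) → π' = π

/-- `π` is an extreme function for `R_f(G,S)`. -/
def IsExtreme (f : G) (S : AddSubgroup G) (π : G → ℝ) : Prop :=
  IsValid f S π ∧ ∀ π₁ π₂ : G → ℝ, IsValid f S π₁ → IsValid f S π₂ →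
    (∀ r, π r = (1 / 2 : ℝ) * (π₁ r + π₂ r)) → π₁ = π ∧ π₂ = π

/-- `P(π)`: the feasible solutions `y` (before taking the convex hull) with `∑ r, π(r) y(r) = 1`. -/
def tightSolutions (f : G) (S : AddSubgroup G) (π : G → ℝ) : Set (G →₀ ℝ) :=
  {y | y ∈ feasibleSolutions f S ∧ pairing π y = 1}

/-- `π` is a facet for `R_f(G,S)`. -/
def IsFacet (f : G) (S : AddSubgroup G) (π : G → ℝ) : Prop :=
  IsValid f S π ∧ ∀ π' : G → ℝ, IsValid f S π' →
    tightSolutions f S π ⊆ tightSolutions f S π' → π' = π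

end General

/-- The subgroup `ℤ` of `ℝ`. -/
def integers : AddSubgroup ℝ := AddSubgroup.zmultiples (1 : ℝ)

/-- The subgroup `(1/n)ℤ` of `ℝ` (used for `n ≥ 1`). -/
noncomputable def grid (n : ℕ) : AddSubgroup ℝ := AddSubgroup.zmultiples ((1 : ℝ) / (n : ℝ))

/-- `ℤ`, regarded as a subgroup of `(1/n)ℤ`. -/
noncomputable def gridIntegers (n : ℕ) : AddSubgroup (grid n) := integers.addSubgroupOf (grid n)

/-- `(1/q)ℤ ⊆ (1/(mq))ℤ` for `m ≥ 1`. -/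
theorem grid_le_grid_mul {m : ℕ} (hm : 0 < m) (q : ℕ) : grid q ≤ grid (m * q) := by
  unfold grid
  rw [AddSubgroup.zmultiples_le]
  refine AddSubgroup.mem_zmultiples_iff.mpr ⟨(m : ℤ), ?_⟩
  have hm' : (m : ℝ) ≠ 0 := by exact_mod_cast hm.ne'
  push_cast
  rw [zsmul_eq_mul, Int.cast_natCast, one_div, mul_inv, one_div, ← mul_assoc,
    mul_inv_cancel₀ hm', one_mul]

/-- `π` is affine over `U ⊆ ℝ`. -/
def IsAffineOver (π : ℝ → ℝ) (U : Set ℝ) : Prop :=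
  ∃ c : ℝ, ∀ u₁ ∈ U, ∀ u₂ ∈ U, π u₂ - π u₁ = c * (u₂ - u₁)

/-- `π` is continuous piecewise linear with breakpoints in `(1/q)ℤ` (for `q ≥ 1`): it is affine over
each closed interval `[k/q, (k+1)/q]`, `k ∈ ℤ`. Continuity is automatic because neighbouring
closed intervals share an endpoint. -/
def IsContinuousPiecewiseLinear (q : ℕ) (π : ℝ → ℝ) : Prop :=
  ∀ k : ℤ, IsAffineOver π (Set.Icc ((k : ℝ) / (q : ℝ)) (((k : ℝ) + 1) / (q : ℝ)))

end GroupProblem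

/-! Minimal functions are exactly the valid ones with `π r + π (f - r) = 1`; they are also
subadditive and periodic, and vanish on the subgroup. Tight solutions record these symmetry
relations and the additivity relations `π x + π y = π (x + y)`. A facet is extreme because equality
in an average of two inequalities forces both to be tight. Extremality passes to the grid because
piecewise linear interpolation preserves averages and subadditivity.

The remaining step, from the grid back to facets, studies the difference `φ` between `π` and a valid
function that is tight wherever `π` is. It is bounded and inherits every additivity of `π`. On the
grid the positive slacks are bounded below, so small multiples `±ε φ` can be added to `π`;
extremality forces `φ = 0` there (`IsMinimalValid.perturbation_eq_zero`).

To leave the grid, rescale by `q` and consider the unit intervals reached from two-dimensional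
additive faces by translation and reflection. On such a face, Cauchy's equation together with
boundedness and vanishing on the `1/m`-grid gives `φ = 0` (`eq_zero_of_cauchy`); additive edges
carry this along (`Covered.eq_zero`). No interval is missed: otherwise an odd spike at `1/m` and `1
- 1/m` on all uncovered intervals would respect every additivity and be nonzero on the grid
(`IsMinimalValid.covered`). The bound `m ≥ 3` keeps the two spikes apart, and gives the Cauchy
argument its room. -/

namespace GroupProblem

/-! ### Total weights of multiplicity vectors -/

section Weights

variable {G : Type*}

theorem pairing_mapRange (π : G → ℝ) (n : G →₀ ℕ) :
    pairing π (n.mapRange (Nat.cast : ℕ → ℝ) Nat.cast_zero) =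
      Finsupp.linearCombination ℕ π n := by
  rw [pairing, Finsupp.sum_mapRange_index (by simp), Finsupp.linearCombination_apply]
  exact Finsupp.sum_congr fun r _ => by rw [nsmul_eq_mul, mul_comm]

theorem pairing_add (π : G → ℝ) (y z : G →₀ ℝ) : pairing π (y + z) = pairing π y + pairing π z :=
  Finsupp.sum_add_index' (by simp) (by intros; ring)

theorem pairing_smul (π : G → ℝ) (c : ℝ) (y : G →₀ ℝ) : pairing π (c • y) = c * pairing π y := by
  rw [pairing, Finsupp.sum_smul_index (by simp), pairing, Finsupp.mul_sum]
  exact Finsupp.sum_congr fun r _ => by ring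

theorem linearCombination_nonneg {π : G → ℝ} (h : ∀ r, 0 ≤ π r) (n : G →₀ ℕ) :
    0 ≤ Finsupp.linearCombination ℕ π n := by
  rw [Finsupp.linearCombination_apply]
  exact Finset.sum_nonneg fun r _ => nsmul_nonneg (h r) _

theorem linearCombination_eq_erase {M : Type*} [AddCommMonoid M] (g : G → M) (r : G) (n : G →₀ ℕ) :
    Finsupp.linearCombination ℕ g n = n r • g r + Finsupp.linearCombination ℕ g (n.erase r) := by
  conv_lhs => rw [← Finsupp.single_add_erase r n]
  rw [map_add, Finsupp.linearCombination_single]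

theorem linearCombination_update [DecidableEq G] (π : G → ℝ) (r : G) (v : ℝ) (n : G →₀ ℕ) :
    Finsupp.linearCombination ℕ (Function.update π r v) n =
      n r * v + Finsupp.linearCombination ℕ π (n.erase r) := by
  conv_lhs => rw [← Finsupp.single_add_erase r n]
  rw [map_add, Finsupp.linearCombination_single, Function.update_self, nsmul_eq_mul]
  congr 1
  simp only [Finsupp.linearCombination_apply]
  refine Finsupp.sum_congr fun x hx => ?_
  rw [Function.update_of_ne]
  rintro rfl
  simp at hx

theorem linearCombination_single_add_single {M : Type*} [AddCommMonoid M] (g : G → M) (x y : G) :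
    Finsupp.linearCombination ℕ g (Finsupp.single x 1 + Finsupp.single y 1) = g x + g y := by
  simp

end Weights

/-! ### Valid, minimal, extreme and facet functions on an abelian group -/

section General

variable {G : Type*} [AddCommGroup G] {f : G} {S : AddSubgroup G} {π : G → ℝ}

theorem mem_feasibleSolutions_iff {y : G →₀ ℝ} :
    y ∈ feasibleSolutions f S ↔ ∃ n : G →₀ ℕ,
      y = n.mapRange (Nat.cast : ℕ → ℝ) Nat.cast_zero ∧
        Finsupp.linearCombination ℕ id n - f ∈ S := by
  constructor
  · rintro ⟨n, hn, hS⟩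
    exact ⟨n, Finsupp.ext fun r => by simp [hn], by simpa [Finsupp.linearCombination_apply] using hS⟩
  · rintro ⟨n, rfl, hS⟩
    exact ⟨n, fun r => by simp, by simpa [Finsupp.linearCombination_apply] using hS⟩

/-- It is enough to test validity on feasible multiplicity vectors. -/
theorem isValid_iff : IsValid f S π ↔ (∀ r, 0 ≤ π r) ∧ ∀ n : G →₀ ℕ,
    Finsupp.linearCombination ℕ id n - f ∈ S → 1 ≤ Finsupp.linearCombination ℕ π n := by
  refine and_congr_right fun _ => ⟨fun h n hn => ?_, fun h y hy => ?_⟩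
  · rw [← pairing_mapRange]
    exact h _ (subset_convexHull ℝ _ (mem_feasibleSolutions_iff.2 ⟨n, rfl, hn⟩))
  · have hconv : Convex ℝ {y : G →₀ ℝ | 1 ≤ pairing π y} := by
      intro y hy z hz a b ha hb hab
      simp only [Set.mem_ofPred_eq, pairing_add, pairing_smul] at *
      nlinarith
    refine convexHull_min ?_ hconv hy
    intro y hy
    obtain ⟨n, rfl, hn⟩ := mem_feasibleSolutions_iff.1 hy
    simpa [pairing_mapRange] using h n hn

theorem mem_tightSolutions {n : G →₀ ℕ} (hn : Finsupp.linearCombination ℕ id n - f ∈ S)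
    (h : Finsupp.linearCombination ℕ π n = 1) :
    n.mapRange (Nat.cast : ℕ → ℝ) Nat.cast_zero ∈ tightSolutions f S π :=
  ⟨mem_feasibleSolutions_iff.2 ⟨n, rfl, hn⟩, by rw [pairing_mapRange, h]⟩

theorem apply_linearCombination_le (h0 : π 0 = 0) (hsub : ∀ x y, π (x + y) ≤ π x + π y) (n : G →₀ ℕ) :
    π (Finsupp.linearCombination ℕ id n) ≤ Finsupp.linearCombination ℕ π n := by
  have hk : ∀ (r : G) (k : ℕ), π (k • r) ≤ k • π r := by
    intro r k
    induction k with
    | zero => simp [h0]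
    | succ k ih =>
      rw [succ_nsmul, succ_nsmul]
      exact (hsub _ _).trans (by gcongr)
  induction n using Finsupp.induction_linear with
  | zero => simp [h0]
  | add a b ha hb => rw [map_add, map_add]; exact (hsub _ _).trans (add_le_add ha hb)
  | single r k => simpa [Finsupp.linearCombination_single] using hk r k

/-- Subadditive functions with the right values on the coset `f + S` are valid. -/
theorem isValid_of_subadditive (hnn : ∀ r, 0 ≤ π r) (h0 : π 0 = 0)
    (hsub : ∀ x y, π (x + y) ≤ π x + π y) (hf : ∀ s ∈ S, π (f + s) = 1) : IsValid f S π := by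
  refine isValid_iff.2 ⟨hnn, fun n hn => ?_⟩
  have := apply_linearCombination_le h0 hsub n
  rwa [← add_sub_cancel f (Finsupp.linearCombination ℕ id n), hf _ hn] at this

/-- A minimal valid function cannot be lowered at one point. -/
theorem IsMinimalValid.le_of_isValid_update [DecidableEq G] (h : IsMinimalValid f S π) {r : G}
    {v : ℝ} (hv : IsValid f S (Function.update π r v)) : π r ≤ v := by
  by_contra! hlt
  have := h.2 _ hv fun x => by
    rcases eq_or_ne x r with rfl | hx
    · simpa using hlt.le
    · simp [hx]
  have := congrFun this r
  simp only [Function.update_self] at this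
  exact hlt.ne this

/-- Lowering `π r` to the weight of `n₀` would keep validity, since every copy of `r` in a feasible
vector can be replaced by `n₀`. Vanishing on `S`, subadditivity and periodicity follow by choosing
`n₀`. -/
theorem IsMinimalValid.le_linearCombination (h : IsMinimalValid f S π) (r : G) (n₀ : G →₀ ℕ)
    (hn₀ : Finsupp.linearCombination ℕ id n₀ - r ∈ S) :
    π r ≤ Finsupp.linearCombination ℕ π n₀ := by
  classical
  obtain ⟨hnn, hval⟩ := isValid_iff.1 h.1
  refine h.le_of_isValid_update (isValid_iff.2 ⟨fun x => ?_, fun n hn => ?_⟩)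
  · rcases eq_or_ne x r with rfl | hx
    · simpa using linearCombination_nonneg hnn n₀
    · simpa [hx] using hnn x
  · rw [linearCombination_update]
    have := hval (n r • n₀ + n.erase r) ?_
    · simpa using this
    · rw [linearCombination_eq_erase id r n] at hn
      have := S.add_mem (S.nsmul_mem hn₀ (n r)) hn
      rw [map_add, map_nsmul]
      convert this using 1
      rw [nsmul_sub, id]
      abel

theorem IsMinimalValid.eq_zero (h : IsMinimalValid f S π) {s : G} (hs : s ∈ S) : π s = 0 := by
  refine le_antisymm ?_ (h.1.1 s)
  simpa using h.le_linearCombination s 0 (by simpa using hs)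

theorem IsMinimalValid.subadditive (h : IsMinimalValid f S π) (x y : G) :
    π (x + y) ≤ π x + π y := by
  rw [← linearCombination_single_add_single]
  exact h.le_linearCombination (x + y) _ (by simp)

theorem IsMinimalValid.add_mem (h : IsMinimalValid f S π) (x : G) {s : G} (hs : s ∈ S) :
    π (x + s) = π x := by
  refine le_antisymm ?_ ?_
  · have := h.subadditive x s
    rwa [h.eq_zero hs, add_zero] at this
  · have := h.subadditive (x + s) (-s)
    rwa [h.eq_zero (S.neg_mem hs), add_zero, add_neg_cancel_right] at this

theorem IsValid.one_le_add (h : IsValid f S π) (r : G) : 1 ≤ π r + π (f - r) := by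
  rw [← linearCombination_single_add_single]
  exact (isValid_iff.1 h).2 _ (by simp)

/-- Suppose the sum `d` exceeds 1. A feasible vector using `r`, with one copy removed, represents `f
- r`, so its full weight is at least `d`; hence dividing `π r` by `d` keeps validity, and minimality
gives `π r = 0`. The same holds at `f - r`, contradicting `d > 1`. -/
theorem IsMinimalValid.symmetric (h : IsMinimalValid f S π) (r : G) : π r + π (f - r) = 1 := by
  classical
  refine le_antisymm ?_ (h.1.one_le_add r)
  by_contra! hlt
  obtain ⟨hnn, hval⟩ := isValid_iff.1 h.1
  have key : ∀ r, 1 < π r + π (f - r) → π r = 0 := by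
    intro r hlt
    set d := π r + π (f - r) with hd
    have hd0 : 0 < d := by linarith
    have hv : IsValid f S (Function.update π r (π r / d)) := by
      refine isValid_iff.2 ⟨fun x => ?_, fun n hn => ?_⟩
      · rcases eq_or_ne x r with rfl | hx
        · simpa using div_nonneg (hnn x) hd0.le
        · simpa [hx] using hnn x
      · rw [linearCombination_update]
        rcases Nat.eq_zero_or_pos (n r) with h0 | hpos
        · have := hval n hn
          rw [linearCombination_eq_erase π r n, h0] at this
          simpa [h0] using this
        · have hdec : Finsupp.linearCombination ℕ id n - f =
              Finsupp.linearCombination ℕ id ((n r - 1) • Finsupp.single r 1 + n.erase r)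
                - (f - r) := by
            rw [linearCombination_eq_erase id r n]
            obtain ⟨k, hk⟩ := Nat.exists_eq_succ_of_ne_zero hpos.ne'
            rw [hk]
            simp only [Nat.succ_eq_add_one, add_tsub_cancel_right, map_add, map_nsmul,
              Finsupp.linearCombination_single, id, succ_nsmul, zero_nsmul, zero_add]
            abel
          rw [hdec] at hn
          have h1 := h.le_linearCombination (f - r) _ hn
          simp only [map_add, map_nsmul, Finsupp.linearCombination_single, nsmul_eq_mul] at h1
          rw [Nat.cast_sub hpos] at h1
          push_cast at h1
          set P := Finsupp.linearCombination ℕ π (n.erase r)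
          have hP : 0 ≤ P := linearCombination_nonneg hnn _
          have h2 : d ≤ n r * π r + P := by linarith
          have h3 : P / d ≤ P := div_le_self hP hlt.le
          have h4 : 1 ≤ (n r * π r + P) / d := (one_le_div hd0).2 h2
          rw [add_div, mul_div_assoc] at h4
          linarith
    have h1 := h.le_of_isValid_update hv
    rw [le_div_iff₀ hd0] at h1
    nlinarith [hnn r]
  have h1 := key r hlt
  have h2 := key (f - r) (by rwa [sub_sub_cancel, add_comm])
  linarith

theorem IsMinimalValid.apply_self_add (h : IsMinimalValid f S π) {s : G} (hs : s ∈ S) :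
    π (f + s) = 1 := by
  rw [h.add_mem f hs]
  simpa [h.eq_zero S.zero_mem] using h.symmetric f

theorem IsMinimalValid.le_one (h : IsMinimalValid f S π) (r : G) : π r ≤ 1 := by
  linarith [h.symmetric r, h.1.1 (f - r)]

theorem isMinimalValid_of_symmetric (h : IsValid f S π) (hsymm : ∀ r, π r + π (f - r) = 1) :
    IsMinimalValid f S π := by
  refine ⟨h, fun π' h' hle => funext fun r => le_antisymm (hle r) ?_⟩
  linarith [hsymm r, h'.one_le_add r, hle (f - r)]

theorem IsMinimalValid.of_average {π₁ π₂ : G → ℝ} (h : IsMinimalValid f S π)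
    (h₁ : IsValid f S π₁) (h₂ : IsValid f S π₂) (havg : ∀ r, π r = (1 / 2 : ℝ) * (π₁ r + π₂ r)) :
    IsMinimalValid f S π₁ := by
  refine isMinimalValid_of_symmetric h₁ fun r => ?_
  linarith [h.symmetric r, h₁.one_le_add r, h₂.one_le_add r, havg r, havg (f - r)]

theorem IsFacet.isExtreme (h : IsFacet f S π) : IsExtreme f S π := by
  refine ⟨h.1, fun π₁ π₂ h₁ h₂ havg => ?_⟩
  have hpair : ∀ y, pairing π y = (1 / 2 : ℝ) * (pairing π₁ y + pairing π₂ y) := by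
    intro y
    simp only [pairing, Finsupp.sum, ← Finset.sum_add_distrib, Finset.mul_sum, havg]
    exact Finset.sum_congr rfl fun r _ => by ring
  have hy : ∀ y ∈ tightSolutions f S π, pairing π₁ y = 1 ∧ pairing π₂ y = 1 := by
    rintro y ⟨hy, h1⟩
    have a := h₁.2 y (subset_convexHull ℝ _ hy)
    have b := h₂.2 y (subset_convexHull ℝ _ hy)
    have c := hpair y
    constructor <;> linarith
  exact ⟨h.2 _ h₁ fun y hm => ⟨hm.1, (hy y hm).1⟩, h.2 _ h₂ fun y hm => ⟨hm.1, (hy y hm).2⟩⟩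

/-- A valid function that is tight wherever a minimal function is tight is itself minimal, and it
inherits all additivity relations. -/
theorem IsMinimalValid.of_tightSolutions_subset {π' : G → ℝ} (h : IsMinimalValid f S π)
    (h' : IsValid f S π') (hsub : tightSolutions f S π ⊆ tightSolutions f S π') :
    IsMinimalValid f S π' ∧ ∀ x y, π x + π y = π (x + y) → π' x + π' y = π' (x + y) := by
  have tight : ∀ n : G →₀ ℕ, Finsupp.linearCombination ℕ id n - f ∈ S →
      Finsupp.linearCombination ℕ π n = 1 → Finsupp.linearCombination ℕ π' n = 1 := by
    intro n hn h1
    rw [← pairing_mapRange]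
    exact (hsub (mem_tightSolutions hn h1)).2
  have hsymm : ∀ r, π' r + π' (f - r) = 1 := fun r => by
    rw [← linearCombination_single_add_single]
    exact tight _ (by simp) (by rw [linearCombination_single_add_single, h.symmetric r])
  refine ⟨isMinimalValid_of_symmetric h' hsymm, fun x y hxy => ?_⟩
  -- By symmetry, this feasible vector is tight for `π` precisely when `π x + π y = π (x + y)`.
  have := tight (Finsupp.single x 1 + Finsupp.single y 1 + Finsupp.single (f - (x + y)) 1) (by simp)
    (by simpa [hxy] using h.symmetric (x + y))
  simp only [map_add, Finsupp.linearCombination_single, one_nsmul] at this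
  linarith [hsymm (x + y)]

end General

/-! ### Cauchy's equation on a triangle -/

section Interval

/-- A bounded family in which every value can be doubled vanishes. -/
theorem eq_zero_of_doubling {ι : Type*} (u : ι → ℝ) (B : ℝ) (hB : ∀ i, |u i| ≤ B)
    (h : ∀ i, u i = 0 ∨ ∃ j, u j = 2 * u i) (i : ι) : u i = 0 := by
  have key : ∀ n : ℕ, ∀ i, 2 ^ n * |u i| ≤ B := by
    intro n
    induction n with
    | zero => simpa using hB
    | succ n ih =>
      intro i
      rcases h i with h0 | ⟨j, hj⟩
      · simpa [h0] using (abs_nonneg _).trans (hB i)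
      · have := ih j
        rw [hj, abs_mul, abs_two] at this
        rw [pow_succ]
        linarith
  by_contra hne
  have hpos := abs_pos.2 hne
  obtain ⟨n, hn⟩ := pow_unbounded_of_one_lt (B / |u i|) (one_lt_two)
  rw [div_lt_iff₀ hpos] at hn
  linarith [key n i]

/-- A bounded solution of Cauchy's equation on a triangle that vanishes on the multiples of `1/m`
vanishes identically if `m ≥ 3`. -/
theorem eq_zero_of_cauchy {m : ℕ} (hm : 3 ≤ m) {u v w : ℝ → ℝ} {B : ℝ} (hB : ∀ s, |u s| ≤ B)
    (hu : ∀ j : ℕ, u (j / m) = 0) (hv : ∀ j : ℕ, v (j / m) = 0) (hw : ∀ j : ℕ, w (j / m) = 0)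
    (h : ∀ s t, 0 < s → 0 < t → s + t < 1 → u s + v t = w (s + t)) :
    (∀ s, 0 < s → s < 1 → u s = 0) ∧ (∀ s, 0 < s → s < 1 → v s = 0) ∧
      ∀ s, 0 < s → s < 1 → w s = 0 := by
  have hm0 : (0 : ℝ) < m := by positivity
  obtain ⟨d, hd⟩ : ∃ d : ℝ, d = 1 / m := ⟨_, rfl⟩
  have hd0 : 0 < d := by rw [hd]; positivity
  have hd3 : 3 * d ≤ 1 := by
    have : (3 : ℝ) ≤ m := by exact_mod_cast hm
    rw [hd, mul_one_div, div_le_one hm0]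
    exact this
  have hjd : ∀ j : ℕ, (j : ℝ) / m = j * d := fun j => by rw [hd]; ring
  simp only [hjd] at hu hv hw
  have hu1 : u d = 0 := by simpa using hu 1
  have hv1 : v d = 0 := by simpa using hv 1
  have hw1 : w d = 0 := by simpa using hw 1
  have hu2 : u (d + d) = 0 := by simpa [two_mul] using hu 2
  have hv2 : v (d + d) = 0 := by simpa [two_mul] using hv 2
  have huw : ∀ s, 0 < s → s + d < 1 → u s = w (s + d) := fun s h0 h1 => by
    linarith [h s d h0 hd0 h1]
  have hvw : ∀ s, 0 < s → s + d < 1 → v s = w (s + d) := fun s h0 h1 => by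
    have := h d s hd0 h0 (by linarith)
    rw [add_comm d s] at this
    linarith
  -- Shifting by `d` twice reaches up to `3 * d`, which is where `m ≥ 3` enters.
  have hvv : ∀ s, 0 < s → s < d → v (s + d) = v s := fun s h0 h1 => by
    rw [hvw (s + d) (by linarith) (by linarith), add_assoc, add_comm s,
      ← h (d + d) s (by linarith) h0 (by linarith), hu2, zero_add]
  have hu0 : ∀ s, 0 < s → s < d → u s = 0 := by
    -- Below `d`, `u` and `v` agree and values propagate along `s ↦ 2s` modulo `d`, doubling each
    -- time; at `2s = d` the value is already zero.
    have := eq_zero_of_doubling (fun s : Set.Ioo 0 d => u s) B (fun s => hB s) ?_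
    · exact fun s h0 h1 => this ⟨s, h0, h1⟩
    rintro ⟨s, h0, h1⟩
    have hs : v s = u s := by rw [hvw s h0 (by linarith), huw s h0 (by linarith)]
    rcases lt_trichotomy (s + s) d with hlt | heq | hgt
    · refine Or.inr ⟨⟨s + s, by linarith, hlt⟩, ?_⟩
      have h2 := h s (s + d) h0 (by linarith) (by linarith)
      rw [hvv s h0 h1, ← add_assoc, ← huw (s + s) (by linarith) (by linarith), hs] at h2
      simp only
      linarith
    · refine Or.inl ?_
      have h2 := h s s h0 h0 (by linarith)
      rw [heq, hw1, hs] at h2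
      simp only
      linarith
    · refine Or.inr ⟨⟨s + s - d, by linarith, by linarith⟩, ?_⟩
      have h2 := h s s h0 h0 (by linarith)
      have h3 := huw (s + s - d) (by linarith) (by linarith)
      rw [sub_add_cancel] at h3
      simp only
      linarith
  have hv0 : ∀ s, 0 < s → s < d → v s = 0 := fun s h0 h1 => by
    rw [hvw s h0 (by linarith), ← huw s h0 (by linarith), hu0 s h0 h1]
  have split : ∀ s, 0 < s → (s < d) ∨ (∃ j : ℕ, s = j * d) ∨
      ∃ j : ℕ, ∃ t, 0 < (j : ℝ) * d ∧ 0 < t ∧ t < d ∧ s = j * d + t := by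
    intro s h0
    rcases lt_or_ge s d with h1 | h1
    · exact Or.inl h1
    right
    set j := ⌊s / d⌋₊ with hj
    have hj1 : (j : ℝ) * d ≤ s := (le_div_iff₀ hd0).1 (Nat.floor_le (by positivity))
    have hj2 : s < (j + 1) * d := (div_lt_iff₀ hd0).1 (Nat.lt_floor_add_one _)
    have hj3 : 1 ≤ j := Nat.le_floor (by rw [Nat.cast_one]; exact (one_le_div hd0).2 h1)
    have hj4 : (1 : ℝ) ≤ j := by exact_mod_cast hj3
    rcases hj1.eq_or_lt with he | hlt
    · exact Or.inl ⟨j, he.symm⟩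
    · exact Or.inr ⟨j, s - j * d, by positivity, by linarith, by linarith, by ring⟩
  have hall : (∀ s, 0 < s → s < 1 → u s = 0) ∧ (∀ s, 0 < s → s < 1 → v s = 0) := by
    refine ⟨fun s h0 h1 => ?_, fun s h0 h1 => ?_⟩
    · rcases split s h0 with hs | ⟨j, rfl⟩ | ⟨j, t, hj, ht0, ht1, rfl⟩
      · exact hu0 s h0 hs
      · exact hu j
      -- A small `e` keeps `t + e` below `d` and the total below 1; splitting `j * d + t + e` in two
      -- ways then expresses `u (j * d + t)` through known zeros.
      · obtain ⟨e, he0, he⟩ : ∃ e, 0 < e ∧ e < min (d - t) (1 - (j * d + t)) :=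
          exists_between (lt_min (by linarith) (by linarith))
        obtain ⟨he1, he2⟩ := lt_min_iff.1 he
        have a := h (j * d + t) e h0 he0 (by linarith)
        have b := h (j * d) (t + e) hj (by linarith) (by linarith)
        rw [hv0 e he0 (by linarith)] at a
        rw [hu, hv0 (t + e) (by linarith) (by linarith), ← add_assoc] at b
        linarith
    · rcases split s h0 with hs | ⟨j, rfl⟩ | ⟨j, t, hj, ht0, ht1, rfl⟩
      · exact hv0 s h0 hs
      · exact hv j
      · obtain ⟨e, he0, he⟩ : ∃ e, 0 < e ∧ e < min (d - t) (1 - (j * d + t)) :=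
          exists_between (lt_min (by linarith) (by linarith))
        obtain ⟨he1, he2⟩ := lt_min_iff.1 he
        have a := h e (j * d + t) he0 h0 (by linarith)
        have b := h (e + t) (j * d) (by linarith) hj (by linarith)
        rw [hu0 e he0 (by linarith)] at a
        rw [hv, hu0 (e + t) (by linarith) (by linarith), add_assoc, add_comm t] at b
        linarith
  refine ⟨hall.1, hall.2, fun s h0 h1 => ?_⟩
  have := h (s / 2) (s / 2) (by linarith) (by linarith) (by linarith)
  rw [hall.1 _ (by linarith) (by linarith), hall.2 _ (by linarith) (by linarith),
    add_halves] at this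
  linarith

end Interval

/-! ### Additive faces and covered intervals -/

section Covering

variable {p : ℝ → ℝ}

/-- `p` is affine on every interval `[k, k + 1]`. -/
def IsUnitPiecewiseLinear (p : ℝ → ℝ) : Prop :=
  ∀ k : ℤ, ∃ c : ℝ, ∀ t : ℝ, 0 ≤ t → t ≤ 1 → p (k + t) = p k + c * t

/-- The intervals `[k, k + 1]` that are covered by additive two-dimensional faces of `p`, directly
or through translations and reflections given by additive edges. -/
inductive Covered (p : ℝ → ℝ) : ℤ → Prop
  | left {a b : ℤ} {s t : ℝ} (hs : s ∈ Set.Ioo 0 1) (ht : t ∈ Set.Ioo 0 1) (hst : s + t ≠ 1)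
      (h : p (a + s) + p (b + t) = p (a + s + (b + t))) : Covered p a
  | sum {a b : ℤ} {s t : ℝ} (hs : s ∈ Set.Ioo 0 1) (ht : t ∈ Set.Ioo 0 1) (hst : s + t ≠ 1)
      (h : p (a + s) + p (b + t) = p (a + s + (b + t))) : Covered p ⌊a + s + (b + t)⌋
  | translate {a b : ℤ} {s : ℝ} (hs : s ∈ Set.Ioo 0 1)
      (h : p (a + s) + p b = p (a + s + b)) (hc : Covered p a) : Covered p (a + b)
  | translate_back {a b : ℤ} {s : ℝ} (hs : s ∈ Set.Ioo 0 1)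
      (h : p (a + s) + p b = p (a + s + b)) (hc : Covered p (a + b)) : Covered p a
  | reflect {a b : ℤ} {s : ℝ} (hs : s ∈ Set.Ioo 0 1)
      (h : p (a + s) + p (b + (1 - s)) = p (a + s + (b + (1 - s)))) (hc : Covered p a) : Covered p b

/-- The variables are the vertex values of an affine function: nonnegative at the vertices and zero
at an interior point, it vanishes at all three. -/
theorem affine_eq_zero_of_triangle {x y z s t : ℝ} (hx : 0 ≤ x) (hy : 0 ≤ y) (hz : 0 ≤ z)
    (hs : 0 < s) (ht : 0 < t) (hst : s + t < 1) (h : (1 - s - t) * x + s * y + t * z = 0) :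
    x = 0 ∧ y = 0 ∧ z = 0 := by
  have a : 0 ≤ (1 - s - t) * x := mul_nonneg (by linarith) hx
  have b : 0 ≤ s * y := mul_nonneg hs.le hy
  have c : 0 ≤ t * z := mul_nonneg ht.le hz
  refine ⟨?_, ?_, ?_⟩
  · exact (mul_eq_zero.1 (by linarith : (1 - s - t) * x = 0)).resolve_left (by linarith)
  · exact (mul_eq_zero.1 (by linarith : s * y = 0)).resolve_left hs.ne'
  · exact (mul_eq_zero.1 (by linarith : t * z = 0)).resolve_left ht.ne'

theorem affine_eq_zero_of_segment {x y s : ℝ} (hx : 0 ≤ x) (hy : 0 ≤ y)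
    (hs : 0 < s) (hs1 : s < 1) (h : (1 - s) * x + s * y = 0) : x = 0 ∧ y = 0 := by
  have a : 0 ≤ (1 - s) * x := mul_nonneg (by linarith) hx
  have b : 0 ≤ s * y := mul_nonneg hs.le hy
  refine ⟨?_, ?_⟩
  · exact (mul_eq_zero.1 (by linarith : (1 - s) * x = 0)).resolve_left (by linarith)
  · exact (mul_eq_zero.1 (by linarith : s * y = 0)).resolve_left hs.ne'

variable (hp : IsUnitPiecewiseLinear p) (hsub : ∀ x y, p (x + y) ≤ p x + p y)
include hp hsub

/-- The slack `p x + p y - p (x + y)` is affine on the triangle and nonnegative at its vertices, so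
one interior zero makes it vanish throughout. -/
theorem additive_lower_triangle {a b : ℤ} {s t : ℝ} (hs : 0 < s) (ht : 0 < t) (hst : s + t < 1)
    (h : p (a + s) + p (b + t) = p (a + s + (b + t))) {s' t' : ℝ} (hs' : 0 < s') (ht' : 0 < t')
    (hst' : s' + t' < 1) : p (a + s') + p (b + t') = p (a + s' + (b + t')) := by
  obtain ⟨c, hc⟩ := hp a
  obtain ⟨d, hd⟩ := hp b
  obtain ⟨e, he⟩ := hp (a + b)
  have expand : ∀ s t : ℝ, 0 ≤ s → 0 ≤ t → s + t ≤ 1 → p (a + s) + p (b + t) - p (a + s + (b + t)) =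
      (p a + p b - p (a + b)) + (c - e) * s + (d - e) * t := by
    intro s t h0 h1 h2
    rw [hc s h0 (by linarith), hd t h1 (by linarith),
      show (a : ℝ) + s + (b + t) = ((a + b : ℤ) : ℝ) + (s + t) by push_cast; ring,
      he (s + t) (by linarith) h2]
    push_cast
    ring
  have e0 := expand s t hs.le ht.le hst.le
  have e1 := expand 1 0 (by norm_num) le_rfl (by norm_num)
  have e2 := expand 0 1 le_rfl (by norm_num) (by norm_num)
  have e3 := expand s' t' hs'.le ht'.le hst'.le
  obtain ⟨hx, hy, hz⟩ := affine_eq_zero_of_triangle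
    (x := p a + p b - p (a + b)) (y := (p a + p b - p (a + b)) + (c - e))
    (z := (p a + p b - p (a + b)) + (d - e)) (by linarith [hsub a b])
    (by linarith [hsub (a + 1) (b + 0)]) (by linarith [hsub (a + 0) (b + 1)]) hs ht hst
    (by linarith)
  have hce : c - e = 0 := by linarith
  have hde : d - e = 0 := by linarith
  rw [hx, hce, hde] at e3
  linarith

omit hsub in
theorem IsUnitPiecewiseLinear.comp_neg : IsUnitPiecewiseLinear fun x => p (-x) := by
  intro k
  obtain ⟨c, hc⟩ := hp (-k - 1)
  refine ⟨-c, fun t h0 h1 => ?_⟩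
  have a := hc (1 - t) (by linarith) (by linarith)
  have b := hc 1 (by linarith) le_rfl
  push_cast at a b
  rw [show -(k : ℝ) - 1 + (1 - t) = -(k + t) by ring] at a
  rw [show -(k : ℝ) - 1 + 1 = -k by ring] at b
  simp only [a, b]
  ring

theorem additive_upper_triangle {a b : ℤ} {s t : ℝ} (hs : s < 1) (ht : t < 1) (hst : 1 < s + t)
    (h : p (a + s) + p (b + t) = p (a + s + (b + t))) {s' t' : ℝ} (hs' : s' < 1) (ht' : t' < 1)
    (hst' : 1 < s' + t') : p (a + s') + p (b + t') = p (a + s' + (b + t')) := by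
  have e : ∀ (a : ℤ) (s : ℝ), (a : ℝ) + s = -(((-a - 1 : ℤ) : ℝ) + (1 - s)) := by
    intro a s; push_cast; ring
  have := additive_lower_triangle (p := fun x => p (-x)) hp.comp_neg
    (fun x y => by simpa only [neg_add] using hsub (-x) (-y)) (a := -a - 1) (b := -b - 1)
    (s := 1 - s) (t := 1 - t) (by linarith) (by linarith) (by linarith)
    (by simpa only [neg_add_rev, add_comm, ← e, ← neg_add] using h)
    (s' := 1 - s') (t' := 1 - t') (by linarith) (by linarith) (by linarith)
  rw [e a s', e b t']
  simpa only [neg_add_rev, add_comm] using this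

theorem additive_translate {a b : ℤ} {s : ℝ} (hs : s ∈ Set.Ioo 0 1)
    (h : p (a + s) + p b = p (a + s + b)) {s' : ℝ} (hs' : s' ∈ Set.Ioo 0 1) :
    p (a + s') + p b = p (a + s' + b) := by
  obtain ⟨c, hc⟩ := hp a
  obtain ⟨e, he⟩ := hp (a + b)
  have expand : ∀ s : ℝ, 0 ≤ s → s ≤ 1 → p (a + s) + p b - p (a + s + b) =
      (p a + p b - p (a + b)) + (c - e) * s := by
    intro s h0 h1
    rw [hc s h0 h1, show (a : ℝ) + s + b = ((a + b : ℤ) : ℝ) + s by push_cast; ring, he s h0 h1]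
    push_cast
    ring
  have e0 := expand s hs.1.le hs.2.le
  have e1 := expand 1 (by norm_num) le_rfl
  have e3 := expand s' hs'.1.le hs'.2.le
  obtain ⟨hx, hy⟩ := affine_eq_zero_of_segment
    (x := p a + p b - p (a + b)) (y := (p a + p b - p (a + b)) + (c - e)) (by linarith [hsub a b])
    (by linarith [hsub (a + 1) b]) hs.1 hs.2 (by linarith)
  have hce : c - e = 0 := by linarith
  rw [hx, hce] at e3
  linarith

/-- Along the antidiagonal edge the sum of the arguments is the constant `a + b + 1`, so the slack
is affine in `s`. -/
theorem additive_reflect {a b : ℤ} {s : ℝ} (hs : s ∈ Set.Ioo 0 1)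
    (h : p (a + s) + p (b + (1 - s)) = p (a + s + (b + (1 - s)))) {s' : ℝ}
    (hs' : s' ∈ Set.Ioo 0 1) :
    p (a + s') + p (b + (1 - s')) = p (a + s' + (b + (1 - s'))) := by
  obtain ⟨c, hc⟩ := hp a
  obtain ⟨e, he⟩ := hp b
  have expand : ∀ s : ℝ, 0 ≤ s → s ≤ 1 →
      p (a + s) + p (b + (1 - s)) - p (a + s + (b + (1 - s))) =
      (p a + p b + e - p (a + b + 1)) + (c - e) * s := by
    intro s h0 h1
    rw [hc s h0 h1, he (1 - s) (by linarith) (by linarith),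
      show (a : ℝ) + s + (b + (1 - s)) = a + b + 1 by ring]
    ring
  have e0 := expand s hs.1.le hs.2.le
  have e1 := expand 1 (by norm_num) le_rfl
  have e2 := expand 0 le_rfl (by norm_num)
  have e3 := expand s' hs'.1.le hs'.2.le
  obtain ⟨hx, hy⟩ := affine_eq_zero_of_segment
    (x := p a + p b + e - p (a + b + 1)) (y := (p a + p b + e - p (a + b + 1)) + (c - e))
    (by linarith [hsub (a + 0) (b + (1 - 0))]) (by linarith [hsub (a + 1) (b + (1 - 1))])
    hs.1 hs.2 (by linarith)
  have hce : c - e = 0 := by linarith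
  rw [hx, hce] at e3
  linarith

/-- On an additive triangle a bounded perturbation that vanishes on `(1/m)ℤ` vanishes. -/
theorem eq_zero_of_additive_triangle {m : ℕ} (hm : 3 ≤ m) {φ : ℝ → ℝ} {B : ℝ} (hB : ∀ x, |φ x| ≤ B)
    (hadd : ∀ x y, p x + p y = p (x + y) → φ x + φ y = φ (x + y))
    (hφ : ∀ j : ℤ, φ (j / m) = 0) {a b : ℤ} {s t : ℝ} (hs : s ∈ Set.Ioo 0 1)
    (ht : t ∈ Set.Ioo 0 1) (hst : s + t ≠ 1) (h : p (a + s) + p (b + t) = p (a + s + (b + t))) :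
    (∀ r ∈ Set.Ioo (0 : ℝ) 1, φ (a + r) = 0) ∧
      ∀ r ∈ Set.Ioo (0 : ℝ) 1, φ (⌊a + s + (b + t)⌋ + r) = 0 := by
  have hm0 : (m : ℝ) ≠ 0 := by positivity
  have grid : ∀ (a : ℤ) (j : ℕ), φ (a + j / m) = 0 := by
    intro a j
    have := hφ (a * m + j)
    push_cast at this
    rwa [add_div, mul_div_cancel_right₀ _ hm0] at this
  have grid' : ∀ (a : ℤ) (j : ℕ), φ (a + (1 - j / m)) = 0 := by
    intro a j
    have := hφ ((a + 1) * m - j)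
    push_cast at this
    rwa [sub_div, mul_div_cancel_right₀ _ hm0, ← add_sub_assoc'] at this
  rcases lt_or_gt_of_ne hst with hlt | hgt
  · have hfl : ⌊(a : ℝ) + s + (b + t)⌋ = a + b := by
      rw [Int.floor_eq_iff]; push_cast; constructor <;> linarith [hs.1, ht.1]
    obtain ⟨hu, -, hw⟩ := eq_zero_of_cauchy hm (u := fun s => φ (a + s)) (v := fun s => φ (b + s))
      (w := fun s => φ ((a + b : ℤ) + s)) (fun s => hB _) (grid a) (grid b) (grid (a + b))
      (fun s' t' h0 h1 h2 => by
        have := hadd _ _ (additive_lower_triangle hp hsub hs.1 ht.1 hlt h h0 h1 h2)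
        rw [this]
        push_cast
        congr 1
        ring)
    rw [hfl]
    exact ⟨fun r hr => hu r hr.1 hr.2, fun r hr => hw r hr.1 hr.2⟩
  · have hfl : ⌊(a : ℝ) + s + (b + t)⌋ = a + b + 1 := by
      rw [Int.floor_eq_iff]; push_cast; constructor <;> linarith [hs.2, ht.2]
    -- The substitution `s ↦ 1 - s` turns the upper triangle into the one treated by
    -- `eq_zero_of_cauchy`.
    obtain ⟨hu, -, hw⟩ := eq_zero_of_cauchy hm (u := fun s => φ (a + (1 - s)))
      (v := fun s => φ (b + (1 - s))) (w := fun s => φ ((a + b + 1 : ℤ) + (1 - s))) (fun s => hB _)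
      (grid' a) (grid' b) (grid' (a + b + 1))
      (fun s' t' h0 h1 h2 => by
        have := hadd _ _ (additive_upper_triangle hp hsub hs.2 ht.2 hgt h
          (s' := 1 - s') (t' := 1 - t') (by linarith) (by linarith) (by linarith))
        rw [this]
        push_cast
        congr 1
        ring)
    rw [hfl]
    refine ⟨fun r hr => ?_, fun r hr => ?_⟩
    · simpa using hu (1 - r) (by linarith [hr.2]) (by linarith [hr.1])
    · simpa using hw (1 - r) (by linarith [hr.2]) (by linarith [hr.1])

theorem Covered.eq_zero {m : ℕ} (hm : 3 ≤ m) {φ : ℝ → ℝ} {B : ℝ} (hB : ∀ x, |φ x| ≤ B)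
    (hadd : ∀ x y, p x + p y = p (x + y) → φ x + φ y = φ (x + y))
    (hφ : ∀ j : ℤ, φ (j / m) = 0) {k : ℤ} (hk : Covered p k) :
    ∀ r ∈ Set.Ioo (0 : ℝ) 1, φ (k + r) = 0 := by
  have hm0 : (m : ℝ) ≠ 0 := by positivity
  have hint : ∀ a : ℤ, φ a = 0 := by
    intro a
    have := hφ (a * m)
    push_cast at this
    rwa [mul_div_cancel_right₀ _ hm0] at this
  induction hk with
  | left hs ht hst h => exact (eq_zero_of_additive_triangle hp hsub hm hB hadd hφ hs ht hst h).1
  | sum hs ht hst h => exact (eq_zero_of_additive_triangle hp hsub hm hB hadd hφ hs ht hst h).2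
  | @translate a b s hs h _ ih =>
    intro r hr
    have := hadd _ _ (additive_translate hp hsub hs h hr)
    rw [ih r hr, hint, add_zero] at this
    rw [this]
    push_cast
    congr 1
    ring
  | @translate_back a b s hs h _ ih =>
    intro r hr
    have := hadd _ _ (additive_translate hp hsub hs h hr)
    rw [hint, add_zero] at this
    rw [this, ← ih r hr]
    push_cast
    congr 1
    ring
  | @reflect a b s hs h _ ih =>
    intro r hr
    have hr' : 1 - r ∈ Set.Ioo (0 : ℝ) 1 := ⟨by linarith [hr.2], by linarith [hr.1]⟩
    have := hadd _ _ (additive_reflect hp hsub hs h hr')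
    rw [ih _ hr', sub_sub_cancel, show (a : ℝ) + (1 - r) + (b + r) = ((a + b + 1 : ℤ) : ℝ) by
      push_cast; ring, hint] at this
    linarith

end Covering

/-! ### A perturbation supported on uncovered intervals -/

section Equivariant

/-- The odd profile supported on the fractional parts `1/m` and `1 - 1/m`. -/
noncomputable def oddProfile (m : ℕ) (s : ℝ) : ℝ :=
  (if s = 1 / m then 1 else 0) - (if 1 - s = 1 / m then 1 else 0)

theorem oddProfile_one_sub (m : ℕ) (s : ℝ) : oddProfile m (1 - s) = -oddProfile m s := by
  simp [oddProfile]

theorem oddProfile_zero {m : ℕ} (hm : 3 ≤ m) : oddProfile m 0 = 0 := by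
  have h3 : (3 : ℝ) ≤ m := by exact_mod_cast hm
  have h1 : (0 : ℝ) ≠ 1 / m := (by positivity : (0 : ℝ) < 1 / m).ne
  have h2 : (1 : ℝ) - 0 ≠ 1 / m := by
    have : (1 : ℝ) / m < 1 := by rw [div_lt_one (by linarith)]; linarith
    linarith
  rw [oddProfile, if_neg h1, if_neg h2, sub_zero]

theorem oddProfile_one_div {m : ℕ} (hm : 3 ≤ m) : oddProfile m (1 / m) = 1 := by
  have h3 : (3 : ℝ) ≤ m := by exact_mod_cast hm
  have h2 : (1 : ℝ) - 1 / m ≠ 1 / m := by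
    have : (1 : ℝ) / m ≤ 1 / 3 := one_div_le_one_div_of_le (by norm_num) h3
    linarith
  rw [oddProfile, if_pos rfl, if_neg h2, sub_zero]

theorem abs_oddProfile_le (m : ℕ) (s : ℝ) : |oddProfile m s| ≤ 1 := by
  unfold oddProfile
  split_ifs <;> norm_num

open Classical in
/-- The perturbation that is the odd profile on every uncovered interval and zero elsewhere. -/
noncomputable def equivariantPerturbation (m : ℕ) (p : ℝ → ℝ) (x : ℝ) : ℝ :=
  if Covered p ⌊x⌋ then 0 else oddProfile m (Int.fract x)

theorem abs_equivariantPerturbation_le (m : ℕ) (p : ℝ → ℝ) (x : ℝ) :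
    |equivariantPerturbation m p x| ≤ 1 := by
  unfold equivariantPerturbation
  split_ifs
  · simp
  · exact abs_oddProfile_le _ _

theorem equivariantPerturbation_intCast {m : ℕ} (hm : 3 ≤ m) (p : ℝ → ℝ) (k : ℤ) :
    equivariantPerturbation m p k = 0 := by
  simp [equivariantPerturbation, oddProfile_zero hm]

open Classical in
theorem equivariantPerturbation_add {s : ℝ} (hs : s ∈ Set.Ioo 0 1) (m : ℕ) (p : ℝ → ℝ) (k : ℤ) :
    equivariantPerturbation m p (k + s) = if Covered p k then 0 else oddProfile m s := by
  have h1 : ⌊(k : ℝ) + s⌋ = k := by rw [Int.floor_eq_iff]; constructor <;> linarith [hs.1, hs.2]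
  have h2 : Int.fract ((k : ℝ) + s) = s := by
    rw [Int.fract, h1]; ring
  rw [equivariantPerturbation, h1, h2]

theorem exists_eq_intCast_or (x : ℝ) :
    (∃ k : ℤ, x = k) ∨ ∃ k : ℤ, ∃ s ∈ Set.Ioo (0 : ℝ) 1, x = k + s := by
  rcases (Int.fract_nonneg x).eq_or_lt with h | h
  · refine Or.inl ⟨⌊x⌋, ?_⟩
    linarith [Int.floor_add_fract x]
  · exact Or.inr ⟨⌊x⌋, Int.fract x, ⟨h, Int.fract_lt_one x⟩, (Int.floor_add_fract x).symm⟩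

/-- Additivity in the interior of a two-dimensional face involves only covered intervals. On an
edge, both intervals are covered or neither is: translations keep the profile, and reflections are
absorbed by its oddness. -/
theorem equivariantPerturbation_additive {m : ℕ} (hm : 3 ≤ m) {p : ℝ → ℝ} (x y : ℝ)
    (h : p x + p y = p (x + y)) :
    equivariantPerturbation m p x + equivariantPerturbation m p y =
      equivariantPerturbation m p (x + y) := by
  have trans : ∀ (a b : ℤ) (s : ℝ), s ∈ Set.Ioo (0 : ℝ) 1 → p (a + s) + p b = p (a + s + b) →
      equivariantPerturbation m p (a + s) + equivariantPerturbation m p b =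
        equivariantPerturbation m p (a + s + b) := by
    intro a b s hs h
    have hiff : Covered p a ↔ Covered p (a + b) := ⟨Covered.translate hs h, Covered.translate_back hs h⟩
    rw [show (a : ℝ) + s + b = ((a + b : ℤ) : ℝ) + s by push_cast; ring,
      equivariantPerturbation_intCast hm, equivariantPerturbation_add hs,
      equivariantPerturbation_add hs]
    by_cases hc : Covered p a
    · rw [if_pos hc, if_pos (hiff.1 hc), add_zero]
    · rw [if_neg hc, if_neg (mt hiff.2 hc), add_zero]
  rcases exists_eq_intCast_or x with ⟨a, rfl⟩ | ⟨a, s, hs, rfl⟩ <;>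
    rcases exists_eq_intCast_or y with ⟨b, rfl⟩ | ⟨b, t, ht, rfl⟩
  · rw [← Int.cast_add]
    simp only [equivariantPerturbation_intCast hm, add_zero]
  · rw [add_comm, add_comm (a : ℝ)] at *
    exact trans b a t ht h
  · exact trans a b s hs h
  · by_cases hst : s + t = 1
    · obtain rfl : t = 1 - s := by linarith
      have hiff : Covered p a ↔ Covered p b := by
        refine ⟨Covered.reflect hs h, Covered.reflect (s := 1 - s) ht ?_⟩
        rw [sub_sub_cancel, add_comm, h, add_comm]
      rw [show (a : ℝ) + s + (b + (1 - s)) = ((a + b + 1 : ℤ) : ℝ) by push_cast; ring,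
        equivariantPerturbation_intCast hm, equivariantPerturbation_add hs,
        equivariantPerturbation_add ht, oddProfile_one_sub]
      by_cases hc : Covered p a
      · rw [if_pos hc, if_pos (hiff.1 hc), add_zero]
      · rw [if_neg hc, if_neg (mt hiff.2 hc), add_neg_cancel]
    · have ha : Covered p a := Covered.left hs ht hst h
      have hb : Covered p b := Covered.left (a := b) (b := a) ht hs (by rwa [add_comm]) (by
        rw [add_comm, h, add_comm])
      have hc := Covered.sum hs ht hst h
      rw [equivariantPerturbation_add hs, equivariantPerturbation_add ht, equivariantPerturbation,
        if_pos ha, if_pos hb, if_pos hc, add_zero]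

end Equivariant

/-! ### Restriction to a grid and rigidity of perturbations -/

section Grid

/-- The generator `1/n` of `grid n`. -/
noncomputable def gridGen (n : ℕ) : grid n := ⟨1 / n, AddSubgroup.mem_zmultiples _⟩

theorem coe_zsmul_gridGen (n : ℕ) (i : ℤ) : ((i • gridGen n : grid n) : ℝ) = i / n := by
  simp [gridGen, div_eq_mul_inv]

theorem exists_eq_zsmul_gridGen {n : ℕ} (x : grid n) : ∃ i : ℤ, x = i • gridGen n := by
  obtain ⟨i, hi⟩ := AddSubgroup.mem_zmultiples_iff.1 x.2
  exact ⟨i, Subtype.ext hi.symm⟩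

theorem intCast_div_mem_grid (n : ℕ) (i : ℤ) : (i : ℝ) / n ∈ grid n :=
  coe_zsmul_gridGen n i ▸ (i • gridGen n : grid n).2

theorem mem_integers_iff {x : ℝ} : x ∈ integers ↔ ∃ k : ℤ, x = k := by
  simp [integers, AddSubgroup.mem_zmultiples_iff, eq_comm]

theorem intCast_mem_integers (k : ℤ) : (k : ℝ) ∈ integers := mem_integers_iff.2 ⟨k, rfl⟩

theorem mem_gridIntegers {n : ℕ} {x : grid n} : x ∈ gridIntegers n ↔ (x : ℝ) ∈ integers :=
  AddSubgroup.mem_addSubgroupOf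

theorem nsmul_mem_gridIntegers {n : ℕ} (hn : 0 < n) (x : grid n) : n • x ∈ gridIntegers n := by
  obtain ⟨i, rfl⟩ := exists_eq_zsmul_gridGen x
  rw [mem_gridIntegers, AddSubgroup.coe_nsmul, coe_zsmul_gridGen, nsmul_eq_mul,
    mul_div_cancel₀ _ (by positivity)]
  exact intCast_mem_integers i

variable {n : ℕ} {f : ℝ} {π : ℝ → ℝ}

theorem IsMinimalValid.restrict_grid (h : IsMinimalValid f integers π) (hf : f ∈ grid n) :
    IsMinimalValid (⟨f, hf⟩ : grid n) (gridIntegers n) (fun x : grid n => π x) := by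
  refine isMinimalValid_of_symmetric (isValid_of_subadditive (fun r => h.1.1 r)
    (h.eq_zero integers.zero_mem) (fun x y => h.subadditive x y) fun s hs => ?_)
    fun r => h.symmetric r
  exact h.apply_self_add (mem_gridIntegers.1 hs)

theorem exists_pos_le_of_pos (T : Finset ℝ) : ∃ δ > 0, ∀ t ∈ T, 0 < t → δ ≤ t := by
  induction T using Finset.induction_on with
  | empty => exact ⟨1, one_pos, by simp⟩
  | insert a T _ ih =>
    obtain ⟨δ, hδ, h⟩ := ih
    rcases le_or_gt a 0 with ha | ha
    · refine ⟨δ, hδ, fun t ht htp => ?_⟩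
      rcases Finset.mem_insert.1 ht with rfl | ht
      · linarith
      · exact h t ht htp
    · refine ⟨min δ a, lt_min hδ ha, fun t ht htp => ?_⟩
      rcases Finset.mem_insert.1 ht with rfl | ht
      · exact min_le_right _ _
      · exact (min_le_left _ _).trans (h t ht htp)

/-- On a grid, the positive subadditivity slacks of a minimal function are bounded below. -/
theorem IsMinimalValid.exists_slack_bound (h : IsMinimalValid f integers π) (hn : 0 < n) :
    ∃ δ > 0, ∀ x y : grid n, π x + π y = π (x + y) ∨ δ ≤ π x + π y - π (x + y) := by
  -- By periodicity, these finitely many residue pairs produce every slack on the grid.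
  obtain ⟨δ, hδ, hT⟩ := exists_pos_le_of_pos
    ((Finset.range n ×ˢ Finset.range n).image fun ij : ℕ × ℕ =>
      π ((ij.1 : ℝ) / n) + π ((ij.2 : ℝ) / n) - π ((ij.1 : ℝ) / n + (ij.2 : ℝ) / n))
  have red : ∀ x : grid n, ∃ i < n, ∃ s ∈ integers, (x : ℝ) = (i : ℝ) / n + s := by
    intro x
    obtain ⟨i, rfl⟩ := exists_eq_zsmul_gridGen x
    have hn' : (0 : ℤ) < n := by exact_mod_cast hn
    have h0 := Int.emod_nonneg i hn'.ne'
    have h1 := Int.emod_lt_of_pos i hn'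
    refine ⟨(i % n).toNat, by omega, ((i / n : ℤ) : ℝ), intCast_mem_integers _, ?_⟩
    have h2 : (((i % n).toNat : ℤ) : ℝ) = ((i % n : ℤ) : ℝ) := by rw [Int.toNat_of_nonneg h0]
    have h3 : ((n * (i / n) + i % n : ℤ) : ℝ) = i := by rw [Int.mul_ediv_add_emod]
    rw [Int.cast_natCast] at h2
    rw [Int.cast_add, Int.cast_mul, Int.cast_natCast] at h3
    have hn0 : (n : ℝ) ≠ 0 := by positivity
    rw [coe_zsmul_gridGen, h2, ← h3]
    field_simp
    ring
  refine ⟨δ, hδ, fun x y => ?_⟩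
  obtain ⟨i, hi, s, hs, hx⟩ := red x
  obtain ⟨j, hj, t, ht, hy⟩ := red y
  have hxy : (x : ℝ) + y = ((i : ℝ) / n + (j : ℝ) / n) + (s + t) := by rw [hx, hy]; ring
  rw [hxy, hx, hy, h.add_mem _ hs, h.add_mem _ ht, h.add_mem _ (integers.add_mem hs ht)]
  rcases (h.subadditive ((i : ℝ) / n) ((j : ℝ) / n)).eq_or_lt with heq | hlt
  · exact Or.inl heq.symm
  · refine Or.inr (hT _ ?_ (by linarith))
    exact Finset.mem_image.2 ⟨(i, j), by simp [hi, hj], rfl⟩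

/-- If the restriction to a grid is extreme, then bounded perturbations respecting all
additivity relations vanish on the grid. -/
theorem IsMinimalValid.perturbation_eq_zero (h : IsMinimalValid f integers π) (hn : 0 < n)
    (hf : f ∈ grid n)
    (hext : IsExtreme (⟨f, hf⟩ : grid n) (gridIntegers n) (fun x : grid n => π x))
    {φ : ℝ → ℝ} {B : ℝ} (hB : ∀ x, |φ x| ≤ B)
    (hadd : ∀ x y, π x + π y = π (x + y) → φ x + φ y = φ (x + y))
    (hφ : ∀ s ∈ integers, φ s = 0) (hφf : φ f = 0) (x : grid n) : φ x = 0 := by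
  obtain ⟨δ, hδ, hslack⟩ := h.exists_slack_bound hn
  have hB0 : 0 ≤ B := (abs_nonneg _).trans (hB 0)
  -- Adding `±ε φ` changes a slack by at most `3 * B * ε ≤ δ`; the `+ 1` keeps the denominator
  -- positive when `B = 0`.
  obtain ⟨ε, hε⟩ : ∃ ε, ε = δ / (3 * B + 1) := ⟨_, rfl⟩
  have hε0 : 0 < ε := by rw [hε]; positivity
  have hεB : ε * (3 * B) ≤ δ := by
    have : ε * (3 * B + 1) = δ := by rw [hε]; field_simp
    linarith
  have valid : ∀ σ : ℝ, |σ| = ε →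
      IsValid (⟨f, hf⟩ : grid n) (gridIntegers n) (fun x : grid n => π x + σ * φ x) := by
    intro σ hσ
    have hzero : ∀ s ∈ gridIntegers n, π s + σ * φ s = 0 := fun s hs => by
      rw [h.eq_zero (mem_gridIntegers.1 hs), hφ _ (mem_gridIntegers.1 hs), mul_zero, add_zero]
    have hsub : ∀ x y : grid n, π (x + y : grid n) + σ * φ (x + y : grid n) ≤
        (π x + σ * φ x) + (π y + σ * φ y) := by
      intro x y
      rw [AddSubgroup.coe_add]
      rcases hslack x y with heq | hle
      · rw [← heq, ← hadd _ _ heq]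
        linarith
      · have h1 : |φ x + φ y - φ (x + y)| ≤ 3 * B := by
          rw [abs_le]
          have a := abs_le.1 (hB x)
          have b := abs_le.1 (hB y)
          have c := abs_le.1 (hB (x + y))
          constructor <;> linarith [a.1, a.2, b.1, b.2, c.1, c.2]
        have h2 : |σ * (φ x + φ y - φ (x + y))| ≤ δ := by
          rw [abs_mul, hσ]
          exact (mul_le_mul_of_nonneg_left h1 hε0.le).trans hεB
        linarith [(abs_le.1 h2).1]
    refine isValid_of_subadditive (fun x => ?_) (hzero 0 (gridIntegers n).zero_mem) hsub
      fun s hs => ?_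
    -- Nonnegativity comes from subadditivity: `n • x` is an integer, where the function vanishes,
    -- so `n` times its value at `x` is at least 0.
    · have h1 := apply_linearCombination_le (π := fun x : grid n => π x + σ * φ x)
        (hzero 0 (gridIntegers n).zero_mem) hsub (Finsupp.single x n)
      simp only [Finsupp.linearCombination_single, id] at h1
      rw [hzero _ (nsmul_mem_gridIntegers hn x), nsmul_eq_mul] at h1
      exact nonneg_of_mul_nonneg_right h1 (by exact_mod_cast hn)
    · have h1 := h.apply_self_add (mem_gridIntegers.1 hs)
      have h2 := hadd f s (by
        rw [h1, h.eq_zero (mem_gridIntegers.1 hs), add_zero]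
        simpa using h.apply_self_add integers.zero_mem)
      rw [hφf, hφ _ (mem_gridIntegers.1 hs), add_zero] at h2
      rw [AddSubgroup.coe_add]
      simp only
      rw [h1, ← h2, mul_zero, add_zero]
  have h1 := (hext.2 _ _ (valid ε (abs_of_pos hε0)) (valid (-ε) (by rw [abs_neg, abs_of_pos hε0]))
    fun r => by ring).1
  have h2 := congrFun h1 x
  simp only [add_eq_left, mul_eq_zero] at h2
  exact h2.resolve_left hε0.ne'

end Grid

/-! ### Piecewise linear extension from a grid -/

section Interpolation

/-- Piecewise linear interpolation of a function on the integers. -/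
noncomputable def interpolate (h : ℤ → ℝ) (t : ℝ) : ℝ :=
  (1 - Int.fract t) * h ⌊t⌋ + Int.fract t * h (⌊t⌋ + 1)

theorem interpolate_add (h : ℤ → ℝ) (k : ℤ) {s : ℝ} (h0 : 0 ≤ s) (h1 : s ≤ 1) :
    interpolate h (k + s) = (1 - s) * h k + s * h (k + 1) := by
  rcases h1.eq_or_lt with rfl | h1
  · rw [← Int.cast_one, ← Int.cast_add, interpolate, Int.fract_intCast, Int.floor_intCast]
    simp
  · have e : ⌊(k : ℝ) + s⌋ = k := by rw [Int.floor_eq_iff]; constructor <;> linarith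
    rw [interpolate, Int.fract, e, add_sub_cancel_left]

theorem interpolate_intCast (h : ℤ → ℝ) (k : ℤ) : interpolate h k = h k := by
  simp [interpolate]

theorem interpolate_nonneg {h : ℤ → ℝ} (hnn : ∀ k, 0 ≤ h k) (t : ℝ) : 0 ≤ interpolate h t :=
  add_nonneg (mul_nonneg (by linarith [Int.fract_lt_one t]) (hnn _))
    (mul_nonneg (Int.fract_nonneg t) (hnn _))

/-- On each of the two triangles of a unit square the slack is affine, hence a convex combination of
its vertex values, which are nonnegative by `hsub`. -/
theorem interpolate_subadditive {h : ℤ → ℝ} (hsub : ∀ a b, h (a + b) ≤ h a + h b) (x y : ℝ) :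
    interpolate h (x + y) ≤ interpolate h x + interpolate h y := by
  obtain ⟨a, s, hs0, hs1, rfl⟩ : ∃ (a : ℤ) (s : ℝ), 0 ≤ s ∧ s < 1 ∧ x = a + s :=
    ⟨⌊x⌋, Int.fract x, Int.fract_nonneg x, Int.fract_lt_one x, (Int.floor_add_fract x).symm⟩
  obtain ⟨b, t, ht0, ht1, rfl⟩ : ∃ (b : ℤ) (t : ℝ), 0 ≤ t ∧ t < 1 ∧ y = b + t :=
    ⟨⌊y⌋, Int.fract y, Int.fract_nonneg y, Int.fract_lt_one y, (Int.floor_add_fract y).symm⟩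
  rw [interpolate_add h a hs0 hs1.le, interpolate_add h b ht0 ht1.le]
  have e10 := hsub (a + 1) b
  have e01 := hsub a (b + 1)
  rw [show a + 1 + b = a + b + 1 by ring] at e10
  rw [← add_assoc] at e01
  rcases le_total (s + t) 1 with hle | hle
  · rw [show (a : ℝ) + s + (b + t) = ((a + b : ℤ) : ℝ) + (s + t) by push_cast; ring,
      interpolate_add h _ (by linarith) hle]
    have f1 := mul_le_mul_of_nonneg_left (hsub a b) (by linarith : 0 ≤ 1 - (s + t))
    have f2 := mul_le_mul_of_nonneg_left e10 hs0
    have f3 := mul_le_mul_of_nonneg_left e01 ht0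
    linarith
  · have e11 := hsub (a + 1) (b + 1)
    rw [show a + 1 + (b + 1) = a + b + 1 + 1 by ring] at e11
    rw [show (a : ℝ) + s + (b + t) = ((a + b + 1 : ℤ) : ℝ) + (s + t - 1) by push_cast; ring,
      interpolate_add h _ (by linarith) (by linarith)]
    have f1 := mul_le_mul_of_nonneg_left e11 (by linarith : 0 ≤ s + t - 1)
    have f2 := mul_le_mul_of_nonneg_left e10 (by linarith : 0 ≤ 1 - t)
    have f3 := mul_le_mul_of_nonneg_left e01 (by linarith : 0 ≤ 1 - s)
    linarith

variable {n : ℕ}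

/-- The piecewise linear extension to `ℝ` of a function on `(1/n)ℤ`. -/
noncomputable def gridExtend (π : grid n → ℝ) (x : ℝ) : ℝ :=
  interpolate (fun i => π (i • gridGen n)) (n * x)

theorem gridExtend_coe (hn : 0 < n) (π : grid n → ℝ) (x : grid n) : gridExtend π x = π x := by
  obtain ⟨i, rfl⟩ := exists_eq_zsmul_gridGen x
  rw [gridExtend, coe_zsmul_gridGen, mul_div_cancel₀ _ (by positivity), interpolate_intCast]

theorem IsMinimalValid.gridExtend (hn : 0 < n) {π : grid n → ℝ} {f : grid n}
    (h : IsMinimalValid f (gridIntegers n) π) : IsValid (f : ℝ) integers (gridExtend π) := by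
  have hS : ∀ s ∈ integers, ∃ s' ∈ gridIntegers n, (s' : ℝ) = s := by
    intro s hs
    obtain ⟨k, rfl⟩ := mem_integers_iff.1 hs
    have hk : (k : ℝ) ∈ grid n := by
      have := intCast_div_mem_grid n (k * n)
      rwa [Int.cast_mul, Int.cast_natCast, mul_div_cancel_right₀ _ (by positivity)] at this
    exact ⟨⟨k, hk⟩, mem_gridIntegers.2 hs, rfl⟩
  refine isValid_of_subadditive (fun x => interpolate_nonneg (fun _ => h.1.1 _) _) ?_
    (fun x y => ?_) fun s hs => ?_
  · have := gridExtend_coe hn π 0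
    rwa [h.eq_zero (gridIntegers n).zero_mem] at this
  · rw [GroupProblem.gridExtend, mul_add]
    exact interpolate_subadditive (fun a b => by rw [add_zsmul]; exact h.subadditive _ _) _ _
  · obtain ⟨s', hs', rfl⟩ := hS s hs
    rw [← AddSubgroup.coe_add, gridExtend_coe hn, h.apply_self_add hs']

/-- Each cell of the finer grid lies inside one cell of `(1/q)ℤ`, where `π` is already affine. -/
theorem IsContinuousPiecewiseLinear.gridExtend_restrict {m q : ℕ} (hm : 0 < m) (hq : 0 < q)
    {π : ℝ → ℝ} (hpl : IsContinuousPiecewiseLinear q π) :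
    gridExtend (fun x : grid (m * q) => π x) = π := by
  funext x
  have hm0 : (0 : ℝ) < m := by exact_mod_cast hm
  have hq0 : (0 : ℝ) < q := by exact_mod_cast hq
  obtain ⟨N, hN⟩ : ∃ N : ℝ, N = m * q := ⟨_, rfl⟩
  have hN0 : 0 < N := by rw [hN]; positivity
  have hNc : ((m * q : ℕ) : ℝ) = N := by rw [hN]; push_cast; ring
  obtain ⟨k, hk⟩ : ∃ k, k = ⌊(q : ℝ) * x⌋ := ⟨_, rfl⟩
  obtain ⟨i, hi⟩ : ∃ i, i = ⌊N * x⌋ := ⟨_, rfl⟩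
  have hk0 : (k : ℝ) ≤ q * x := hk ▸ Int.floor_le _
  have hk1 : (q : ℝ) * x < k + 1 := hk ▸ Int.lt_floor_add_one _
  have hi0 : (i : ℝ) ≤ N * x := hi ▸ Int.floor_le _
  have hi1 : N * x < i + 1 := hi ▸ Int.lt_floor_add_one _
  have hki : k * m ≤ i := by
    rw [hi, Int.le_floor, hN]
    push_cast
    nlinarith
  have hik : i + 1 ≤ (k + 1) * m := by
    rw [Int.add_one_le_iff]
    have : (i : ℝ) < ((k + 1) * m : ℤ) := by
      refine hi0.trans_lt ?_
      rw [hN]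
      push_cast
      nlinarith
    exact_mod_cast this
  have hki' : (k : ℝ) * m ≤ i := by exact_mod_cast hki
  have hik' : (i : ℝ) + 1 ≤ (k + 1) * m := by exact_mod_cast hik
  have hkN : (k : ℝ) / q = k * m / N := by rw [hN]; field_simp
  have hkN' : ((k : ℝ) + 1) / q = (k + 1) * m / N := by rw [hN]; field_simp
  obtain ⟨c, hc⟩ := hpl k
  rw [hkN, hkN'] at hc
  have m1 : (i : ℝ) / N ∈ Set.Icc (k * m / N) ((k + 1) * m / N) :=
    ⟨by gcongr, by gcongr; linarith⟩
  have m2 : x ∈ Set.Icc (k * m / N) ((k + 1) * m / N) := by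
    rw [Set.mem_Icc, div_le_iff₀ hN0, le_div_iff₀ hN0, mul_comm x]
    constructor <;> linarith
  have m3 : ((i : ℝ) + 1) / N ∈ Set.Icc (k * m / N) ((k + 1) * m / N) :=
    ⟨by gcongr; linarith, by gcongr⟩
  have e1 := hc _ m1 _ m2
  have e2 := hc _ m1 _ m3
  rw [gridExtend, interpolate, hNc, ← hi]
  simp only [coe_zsmul_gridGen, hNc]
  push_cast
  rw [show Int.fract (N * x) = N * x - i by rw [Int.fract, hi]]
  have e3 : (N * x - i) * (π ((i + 1) / N) - π (i / N)) = π x - π (i / N) := by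
    rw [e1, e2]
    field_simp
    ring
  linarith

/-- Extremeness passes to the restriction to a refining grid. -/
theorem IsExtreme.restrict_grid {m q : ℕ} (hm : 0 < m) (hq : 0 < q) {f : ℝ}
    (hf : f ∈ grid (m * q)) {π : ℝ → ℝ} (hpl : IsContinuousPiecewiseLinear q π)
    (hmin : IsMinimalValid f integers π) (h : IsExtreme f integers π) :
    IsExtreme (⟨f, hf⟩ : grid (m * q)) (gridIntegers (m * q)) (fun x : grid (m * q) => π x) := by
  have hn : 0 < m * q := Nat.mul_pos hm hq
  have hmin' := hmin.restrict_grid hf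
  refine ⟨hmin'.1, fun π₁ π₂ h₁ h₂ havg => ?_⟩
  have hm₁ := hmin'.of_average h₁ h₂ havg
  have hm₂ := hmin'.of_average h₂ h₁ fun r => by linarith [havg r]
  -- Interpolation is linear in the grid values, so it turns the average on the grid into an average
  -- on `ℝ`.
  have key := h.2 _ _ (hm₁.gridExtend hn) (hm₂.gridExtend hn) fun x => by
    rw [← congrFun (hpl.gridExtend_restrict hm hq) x]
    simp only [gridExtend, interpolate, havg]
    ring
  exact ⟨funext fun x => by rw [← gridExtend_coe hn π₁, key.1],
    funext fun x => by rw [← gridExtend_coe hn π₂, key.2]⟩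

end Interpolation

/-! ### From grid extremality to facets -/

section Main

theorem IsContinuousPiecewiseLinear.isUnitPiecewiseLinear {q : ℕ} (hq : 0 < q) {π : ℝ → ℝ}
    (hpl : IsContinuousPiecewiseLinear q π) : IsUnitPiecewiseLinear fun t => π (t / q) := by
  intro k
  obtain ⟨c, hc⟩ := hpl k
  have hq0 : (0 : ℝ) < q := by exact_mod_cast hq
  refine ⟨c / q, fun t h0 h1 => ?_⟩
  have := hc (k / q) ⟨le_rfl, by gcongr; linarith⟩ ((k + t) / q)
    ⟨by gcongr; linarith, by gcongr⟩
  simp only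
  linear_combination this + c * (add_div (k : ℝ) t q)

/-- If the restriction to `(1/mq)ℤ` is extreme, every interval is covered. -/
theorem IsMinimalValid.covered {m q : ℕ} (hm : 3 ≤ m) (hq : 0 < q) {f : ℝ} (hf : f ∈ grid q)
    (hf' : f ∈ grid (m * q)) {π : ℝ → ℝ} (hmin : IsMinimalValid f integers π)
    (hext : IsExtreme (⟨f, hf'⟩ : grid (m * q)) (gridIntegers (m * q))
      (fun x : grid (m * q) => π x)) (k : ℤ) : Covered (fun t => π (t / q)) k := by
  by_contra hk
  have hm0 : (m : ℝ) ≠ 0 := by positivity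
  have hq0 : (q : ℝ) ≠ 0 := by positivity
  set p : ℝ → ℝ := fun t => π (t / q) with hp
  have hpq : ∀ x, p (q * x) = π x := fun x => by rw [hp]; simp only; rw [mul_div_cancel_left₀ _ hq0]
  have := hmin.perturbation_eq_zero (Nat.mul_pos (by omega) hq) hf' hext
    (φ := fun x => equivariantPerturbation m p (q * x))
    (fun x => abs_equivariantPerturbation_le m p _)
    (fun x y h => by
      rw [mul_add]
      refine equivariantPerturbation_additive hm _ _ ?_
      rw [← mul_add, hpq, hpq, hpq, h])
    (fun s hs => by
      obtain ⟨j, rfl⟩ := mem_integers_iff.1 hs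
      have := equivariantPerturbation_intCast hm p (q * j)
      rwa [Int.cast_mul, Int.cast_natCast] at this)
    (by
      obtain ⟨i, hi⟩ := exists_eq_zsmul_gridGen ⟨f, hf⟩
      have hi' : f = i / q := by
        rw [← coe_zsmul_gridGen, ← hi]
      rw [hi', mul_div_cancel₀ _ hq0]
      exact equivariantPerturbation_intCast hm p i)
    -- This grid point rescales to `k + 1/m`, where the spike has value 1 if `k` is uncovered.
    ((k * m + 1 : ℤ) • gridGen (m * q))
  rw [coe_zsmul_gridGen] at this
  have h3 : (3 : ℝ) ≤ m := by exact_mod_cast hm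
  have hs : (1 : ℝ) / m ∈ Set.Ioo (0 : ℝ) 1 :=
    ⟨by positivity, by rw [div_lt_one (by linarith)]; linarith⟩
  rw [show (q : ℝ) * (((k * m + 1 : ℤ) : ℝ) / ((m * q : ℕ) : ℝ)) = k + 1 / m by
    push_cast; field_simp, equivariantPerturbation_add hs, if_neg hk, oddProfile_one_div hm] at this
  exact one_ne_zero this

theorem IsMinimalValid.isFacet_of_restrict_grid {m q : ℕ} (hm : 3 ≤ m) (hq : 0 < q) {f : ℝ}
    (hf : f ∈ grid q) (hf' : f ∈ grid (m * q)) {π : ℝ → ℝ}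
    (hpl : IsContinuousPiecewiseLinear q π) (hmin : IsMinimalValid f integers π)
    (hext : IsExtreme (⟨f, hf'⟩ : grid (m * q)) (gridIntegers (m * q))
      (fun x : grid (m * q) => π x)) : IsFacet f integers π := by
  refine ⟨hmin.1, fun π' hv htight => ?_⟩
  obtain ⟨hmin', hadd⟩ := hmin.of_tightSolutions_subset hv htight
  have hm0 : (m : ℝ) ≠ 0 := by positivity
  have hq0 : (q : ℝ) ≠ 0 := by positivity
  obtain ⟨φ, hφ⟩ : ∃ φ : ℝ → ℝ, ∀ x, φ x = π' x - π x := ⟨_, fun _ => rfl⟩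
  have hB : ∀ x, |φ x| ≤ 1 := fun x => by
    rw [hφ, abs_le]
    constructor <;> linarith [hmin.1.1 x, hmin.le_one x, hmin'.1.1 x, hmin'.le_one x]
  have hφadd : ∀ x y, π x + π y = π (x + y) → φ x + φ y = φ (x + y) := fun x y h => by
    rw [hφ, hφ, hφ, ← hadd x y h, ← h]
    ring
  have hgrid := hmin.perturbation_eq_zero (Nat.mul_pos (by omega) hq) hf' hext hB hφadd
    (fun s hs => by rw [hφ, hmin.eq_zero hs, hmin'.eq_zero hs, sub_zero])
    (by
      have a := hmin.apply_self_add integers.zero_mem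
      have b := hmin'.apply_self_add integers.zero_mem
      rw [add_zero] at a b
      rw [hφ, a, b, sub_self])
  have hscaled : ∀ j : ℤ, φ (j / m / q) = 0 := fun j => by
    have := hgrid (j • gridGen (m * q))
    rwa [coe_zsmul_gridGen, Nat.cast_mul, ← div_div] at this
  have hzero : ∀ t, φ (t / q) = 0 := by
    intro t
    rcases exists_eq_intCast_or t with ⟨k, rfl⟩ | ⟨k, s, hs, rfl⟩
    · have := hscaled (k * m)
      rwa [Int.cast_mul, Int.cast_natCast, mul_div_cancel_right₀ _ hm0] at this
    · exact (hmin.covered hm hq hf hf' hext k).eq_zero (φ := fun t => φ (t / q))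
        (hpl.isUnitPiecewiseLinear hq)
        (fun x y => by simp only [add_div]; exact hmin.subadditive _ _) hm (fun x => hB _)
        (fun x y h => by
          simp only [add_div] at h ⊢
          exact hφadd _ _ h)
        hscaled s hs
  funext x
  have := hzero (q * x)
  rw [mul_div_cancel_left₀ _ hq0, hφ] at this
  linarith

end Main

end GroupProblem

theorem mainTheorem1 (m : ℕ) (hm : 3 ≤ m) (q : ℕ) (hq : 0 < q)
    (f : ℝ) (hf : f ∈ GroupProblem.grid q) (hf' : f ∉ GroupProblem.integers)
    (π : ℝ → ℝ) (hpl : GroupProblem.IsContinuousPiecewiseLinear q π)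
    (hmin : GroupProblem.IsMinimalValid f GroupProblem.integers π) :
    List.TFAE
      [GroupProblem.IsFacet f GroupProblem.integers π,
       GroupProblem.IsExtreme f GroupProblem.integers π,
       GroupProblem.IsExtreme
        (⟨f, GroupProblem.grid_le_grid_mul (Nat.zero_lt_of_lt hm) q hf⟩ : GroupProblem.grid (m * q))
        (GroupProblem.gridIntegers (m * q))
        (fun x : GroupProblem.grid (m * q) => π (x : ℝ))] := by
  tfae_have 1 → 2 := fun h => h.isExtreme
  tfae_have 2 → 3 := fun h => h.restrict_grid (Nat.zero_lt_of_lt hm) hq _ hpl hmin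
  tfae_have 3 → 1 := fun h => hmin.isFacet_of_restrict_grid hm hq hf _ hpl h
  tfae_finish
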